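/- Let $(\mathcal H,\langle\cdot,\cdot\rangle_{\mathcal H})$ and $(\mathcal V,\langle\cdot,\cdot\rangle_{\mathcal V})$ be real separable Hilbert spaces, let $(\Omega,\mathcal F,\mathbb P)$ be a probability space, and let $W=\{W(h):h\in\mathcal H\}$ be an isonormal Gaussian process over $\mathcal H$ on it, that is, a centered Gaussian family with $\mathbb E[W(h)W(g)]=\langle h,g\rangle_{\mathcal H}$ for all $h,g\in\mathcal H$. Let $\mathcal S$ be the set of random variables $f(W(h_1),\dots,W(h_m))$ with $h_1,\dots,h_m\in\mathcal H$ and $f\in C^\infty(\mathbb R^m)$ such that $f$ and all its partial derivatives have at most polynomial growth, and let $\mathcal S_{\mathcal V}$ be the set of random variables $F=\sum_{j=1}^J F_j v_j$ with $F_j=f_j(W(h_{j,1}),\dots,W(h_{j,m_j}))\in\mathcal S$ and $v_j\in\mathcal V$. For such $F$ and $k\ge 1$, the $k$-th Malliavin derivative of $F$ is $$D^kF:=\sum_{j=1}^J\ \sum_{i_1,\dots,i_k=1}^{m_j}\frac{\partial^k f_j}{\partial x_{i_1}\cdots\partial x_{i_k}}\bigl(W(h_{j,1}),\dots,W(h_{j,m_j})\bigr)\,h_{j,i_1}\otimes\cdots\otimes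 h_{j,i_k}\otimes v_j ,$$ a random variable with values in the Hilbert tensor product $\mathcal H^{\otimes k}\otimes\mathcal V$; also $D^0F:=F$ and $\mathcal H^{\otimes 0}\otimes\mathcal V:=\mathcal V$. Write $\|G\|_{L^1(\Omega;E)}:=\mathbb E[\|G\|_E]$. Then, for every integer $\ell\ge 1$ and every $F\in\mathcal S_{\mathcal V}$ (with any representation as above), all $D^kF$, $k\ge 0$, belong to $L^1(\Omega;\mathcal H^{\otimes k}\otimes\mathcal V)$ and $$\left\|D^\ell F\right\|_{L^1(\Omega;\mathcal H^{\otimes\ell}\otimes\mathcal V)}\le\eta\left(\left\|D^{\ell-1}F\right\|_{L^1(\Omega;\mathcal H^{\otimes(\ell-1)}\otimes\mathcal V)}+\left\|D^{\ell+1}F\right\|_{L^1(\Omega;\mathcal H^{\otimes(\ell+1)}\otimes\mathcal V)}\right),\qquad \eta:=\frac{\pi}{2}+18\sqrt{2e}.$$ -/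

import Mathlib

open MeasureTheory ProbabilityTheory TensorProduct

universe u v w

noncomputable section

namespace Malliavin

/-! ### The Hilbert tensor products `H ⊗ ⋯ ⊗ H ⊗ V` -/

/-- A real Hilbert space, bundled with its structure. -/
structure RealHilbert : Type (w + 1) where
  carrier : Type w
  [instNACG : NormedAddCommGroup carrier]
  [instIPS : InnerProductSpace ℝ carrier]
  [instComplete : CompleteSpace carrier]

attribute [instance] RealHilbert.instNACG RealHilbert.instIPS RealHilbert.instComplete

/-- `ULift` only moves a Hilbert space to a larger universe; it carries the same inner product. -/
instance instInnerProductSpaceULift (E : Type v) [NormedAddCommGroup E] [InnerProductSpace ℝ E] :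
    InnerProductSpace ℝ (ULift.{u} E) where
  inner x y := inner ℝ x.down y.down
  norm_sq_eq_re_inner x := norm_sq_eq_re_inner (𝕜 := ℝ) x.down
  conj_inner_symm x y := inner_conj_symm x.down y.down
  add_left x y z := inner_add_left x.down y.down z.down
  smul_left x y r := inner_smul_left x.down y.down r

section Tensor

variable (H : Type u) [NormedAddCommGroup H] [InnerProductSpace ℝ H]
variable (V : Type v) [NormedAddCommGroup V] [InnerProductSpace ℝ V] [CompleteSpace V]

/-- The Hilbert space `H^{⊗ k} ⊗ V`, built as `H ⊗ (H ⊗ ⋯ ⊗ (H ⊗ V))`. Each `⊗` is the Hilbert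
tensor product: the completion of the algebraic tensor product for the inner product
`⟪h ⊗ x, g ⊗ y⟫ = ⟪h, g⟫ ⟪x, y⟫`. For `k = 0` it is `V` itself. -/
def tensorHilbert : ℕ → RealHilbert.{max u v}
  | 0 => ⟨ULift.{u} V⟩
  | k + 1 => ⟨UniformSpace.Completion (H ⊗[ℝ] (tensorHilbert k).carrier)⟩

/-- The underlying space of `H^{⊗ k} ⊗ V`. -/
abbrev HTensor (k : ℕ) : Type (max u v) := (tensorHilbert H V k).carrier

variable {H V}

/-- The elementary tensor `h 0 ⊗ ⋯ ⊗ h (k - 1) ⊗ x` in `H^{⊗ k} ⊗ V`. -/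
def pureTensor : (k : ℕ) → (Fin k → H) → V → HTensor H V k
  | 0, _, x => (ULift.up x : ULift.{u} V)
  | k + 1, h, x =>
    ((h 0 ⊗ₜ[ℝ] pureTensor k (Fin.tail h) x : H ⊗[ℝ] (tensorHilbert H V k).carrier) :
      UniformSpace.Completion (H ⊗[ℝ] (tensorHilbert H V k).carrier))

/-- The inner product of `H^{⊗ k} ⊗ V` is the standard one on elementary tensors. -/
theorem inner_pureTensor (k : ℕ) (h g : Fin k → H) (x y : V) :
    inner ℝ (pureTensor k h x) (pureTensor k g y) =
      (∏ i, inner ℝ (h i) (g i)) * inner ℝ x y := by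
  induction k with
  | zero =>
    simp only [Finset.univ_eq_empty, Finset.prod_empty, one_mul]
    rfl
  | succ k ih =>
    have key : inner ℝ (pureTensor (k + 1) h x) (pureTensor (k + 1) g y) =
        inner ℝ (h 0 ⊗ₜ[ℝ] pureTensor k (Fin.tail h) x) (g 0 ⊗ₜ[ℝ] pureTensor k (Fin.tail g) y) :=
      UniformSpace.Completion.inner_coe (𝕜 := ℝ) _ _
    rw [key, TensorProduct.inner_tmul, ih, Fin.prod_univ_succ, mul_assoc]
    rfl

end Tensor

/-! ### Isonormal Gaussian processes -/

/-- `W` is an isonormal Gaussian process over `H`: a centered Gaussian family indexed by `H` with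
covariance `𝔼[W(h) W(g)] = ⟪h, g⟫`. -/
structure IsIsonormal {H : Type u} [NormedAddCommGroup H] [InnerProductSpace ℝ H]
    {Ω : Type w} [MeasurableSpace Ω] (W : H → Ω → ℝ) (P : Measure Ω) : Prop where
  gaussian : IsGaussianProcess W P
  centered : ∀ h, ∫ ω, W h ω ∂P = 0
  covariance : ∀ h g, ∫ ω, W h ω * W g ω ∂P = inner ℝ h g

/-! ### Smooth random variables and their Malliavin derivatives -/

/-- The data `(m, h, f)` of a smooth real random variable `f(W(h₁), …, W(h_m))`, where `f` is
`C^∞` and `f` and all its derivatives have at most polynomial growth. -/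
structure SmoothScalar (H : Type u) where
  m : ℕ
  h : Fin m → H
  f : EuclideanSpace ℝ (Fin m) → ℝ
  smooth : f.HasTemperateGrowth

/-- The data of a smooth `V`-valued random variable `∑ⱼ Fⱼ vⱼ` with smooth real `Fⱼ` and `vⱼ ∈ V`.
The vectors `h` and `v` need not be orthonormal or independent. -/
structure SmoothVector (H : Type u) (V : Type v) where
  J : ℕ
  F : Fin J → SmoothScalar H
  v : Fin J → V

variable {H : Type u} {V : Type v} {Ω : Type w}

/-- The random vector `(W(h₁), …, W(h_m))`. -/
def SmoothScalar.point (F : SmoothScalar H) (W : H → Ω → ℝ) (ω : Ω) :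
    EuclideanSpace ℝ (Fin F.m) :=
  WithLp.toLp 2 fun i => W (F.h i) ω

/-- The random variable `f(W(h₁), …, W(h_m))`. -/
def SmoothScalar.toRV (F : SmoothScalar H) (W : H → Ω → ℝ) (ω : Ω) : ℝ :=
  F.f (F.point W ω)

/-- The iterated partial derivative `∂^k f / ∂x_{i₁} ⋯ ∂x_{i_k}` at the point `x`. -/
def SmoothScalar.partialDeriv (F : SmoothScalar H) {k : ℕ} (i : Fin k → Fin F.m)
    (x : EuclideanSpace ℝ (Fin F.m)) : ℝ :=
  iteratedFDeriv ℝ k F.f x fun r => EuclideanSpace.single (i r) 1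

/-- The random variable `∑ⱼ Fⱼ vⱼ`. -/
def SmoothVector.toRV [NormedAddCommGroup V] [InnerProductSpace ℝ V] (F : SmoothVector H V)
    (W : H → Ω → ℝ) (ω : Ω) : V :=
  ∑ j, (F.F j).toRV W ω • F.v j

/-- The `k`-th Malliavin derivative, the `H^{⊗ k} ⊗ V`-valued random variable
`D^k F = ∑ⱼ ∑_{i₁, …, i_k} (∂^k fⱼ / ∂x_{i₁} ⋯ ∂x_{i_k})(W(h₁), …, W(h_m)) h_{i₁} ⊗ ⋯ ⊗ h_{i_k} ⊗ vⱼ`.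
For `k = 0` it is `F` itself, see `malliavinD_zero`. -/
def SmoothVector.malliavinD [NormedAddCommGroup H] [InnerProductSpace ℝ H]
    [NormedAddCommGroup V] [InnerProductSpace ℝ V] [CompleteSpace V] (F : SmoothVector H V)
    (W : H → Ω → ℝ) (k : ℕ) (ω : Ω) : HTensor H V k :=
  ∑ j, ∑ i : Fin k → Fin (F.F j).m,
    (F.F j).partialDeriv i ((F.F j).point W ω) • pureTensor k (fun r => (F.F j).h (i r)) (F.v j)

theorem SmoothVector.malliavinD_zero [NormedAddCommGroup H] [InnerProductSpace ℝ H]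
    [NormedAddCommGroup V] [InnerProductSpace ℝ V] [CompleteSpace V] (F : SmoothVector H V)
    (W : H → Ω → ℝ) (ω : Ω) :
    F.malliavinD W 0 ω = (ULift.up (F.toRV W ω) : ULift.{u} V) := by
  have hup : ∀ x : V, (ULift.up x : ULift.{u} V) = (ULift.moduleEquiv (R := ℝ)).symm x :=
    fun _ => rfl
  rw [SmoothVector.toRV, hup, map_sum]
  refine Finset.sum_congr rfl fun j _ => ?_
  rw [Fintype.sum_unique, map_smul]
  rfl

/-- The `L¹(Ω; E)` norm `𝔼[‖G‖]`, as an extended nonnegative real. -/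
abbrev L1norm {E : Type v} [NormedAddCommGroup E] [MeasurableSpace Ω] (P : Measure Ω) (G : Ω → E) :
    ENNReal :=
  eLpNorm G 1 P

/-- The constant `η = π/2 + 18 √(2e)`. -/
def eta : ℝ := Real.pi / 2 + 18 * Real.sqrt (2 * Real.exp 1)

end Malliavin

end

/-!
Write `D^k F` as a function `G_k` of the Gaussian vector `X = (W(h_{j, i}))`, with law `μ`. With `Z`
an independent copy of `X`, the covariance structure gives `𝔼⟪DG_k(x) Z, DG_k(y) Z⟫ =
⟪G_{k+1}(x), G_{k+1}(y)⟫` (`IsIsonormal.integral_inner_sum`), so no orthonormal basis is needed and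
`μ` may be degenerate. It remains to bound `𝔼‖G_{k+1}‖` in terms of `G_k` and `G_{k+2}`.

Everything comes from the rotation invariance of `μ ⊗ μ`. Along the arc `X_s = cos s X + sin s Z`
one has `φ(Z) - φ(X) = ∫₀^{π/2} Dφ(X_s) Z_s ds`, where `(X_s, Z_s)` has the law of `(X, Z)`. Taking
norms gives the Poincaré inequality `𝔼‖φ(Z) - φ(X)‖ ≤ (π/2) 𝔼‖Dφ(X) Z‖` (`integral_norm_sub_le`),
and testing against `T Z` gives integration by parts (`integral_inner_fderiv`).

Fix a point `y` with `N = ‖G_{k+1}(y)‖ > 0`, let `T = DG_k(y) / N`, so that `𝔼‖T X‖² = 1`, and let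
`χ = 1 / (1 + ‖T x‖²)`. Integration by parts for `χ G_k` bounds `𝔼[χ ⟪G_{k+1}(X), G_{k+1}(y)⟫] / N`
by `(3/2) 𝔼‖G_k‖`, because the cutoff makes `χ T x` and the gradient of `χ` bounded; without it
`𝔼⟪G_k(X), T X⟫` is not controlled by `𝔼‖G_k‖`. Replacing `G_{k+1}(X)` by `G_{k+1}(y)` costs the
oscillation `𝔼‖G_{k+1}(y) - G_{k+1}(X)‖`, and `𝔼χ ≥ 1/2`. This yields the pointwise bound `norm_gradient_le`,
and averaging over `y` and the Poincaré inequality give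
`𝔼‖G_{k+1}‖ ≤ 3 𝔼‖G_k‖ + π 𝔼‖G_{k+2}‖`, with constants smaller than `η`.
-/

namespace Malliavin

/-! ### Functions of temperate growth -/

section Growth

variable {X E : Type*} [NormedAddCommGroup X] [NormedSpace ℝ X]
  [NormedAddCommGroup E] [NormedSpace ℝ E]

/-- The bounds on values and first derivatives, with common constants. -/
theorem temperate_bounds {φ : X → E} (hφ : φ.HasTemperateGrowth) :
    ∃ (N : ℕ) (C : ℝ), 0 ≤ C ∧ (∀ x, ‖φ x‖ ≤ C * (1 + ‖x‖) ^ N) ∧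
      ∀ x, ‖fderiv ℝ φ x‖ ≤ C * (1 + ‖x‖) ^ N := by
  obtain ⟨N, C, hC, h⟩ := hφ.norm_iteratedFDeriv_le_uniform 1
  refine ⟨N, C, hC, fun x => ?_, fun x => ?_⟩
  · simpa using h 0 (by simp) x
  · simpa [norm_iteratedFDeriv_one] using h 1 le_rfl x

theorem temperate_fderiv {φ : X → E} (hφ : φ.HasTemperateGrowth) :
    (fderiv ℝ φ).HasTemperateGrowth := by
  refine ⟨hφ.1.fderiv_right (by simp), fun n => ?_⟩
  simpa only [norm_iteratedFDeriv_fderiv] using hφ.2 (n + 1)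

theorem temperate_fderiv_apply {φ : X → E} (hφ : φ.HasTemperateGrowth) (v : X) :
    (fun x => fderiv ℝ φ x v).HasTemperateGrowth :=
  (ContinuousLinearMap.apply ℝ E v).hasTemperateGrowth.comp (temperate_fderiv hφ)

theorem norm_rotation_le (s : ℝ) (p : X × X) :
    ‖ContinuousLinearMap.rotation s p‖ ≤ 2 * ‖p‖ := by
  have h1 := norm_fst_le p
  have h2 := norm_snd_le p
  have key : ∀ a b : ℝ, |a| ≤ 1 → |b| ≤ 1 → ‖a • p.1 + b • p.2‖ ≤ 2 * ‖p‖ := fun a b ha hb => by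
    refine (norm_add_le _ _).trans ?_
    rw [norm_smul, norm_smul, Real.norm_eq_abs, Real.norm_eq_abs]
    nlinarith [norm_nonneg p.1, norm_nonneg p.2]
  rw [ContinuousLinearMap.rotation_apply, Prod.norm_def]
  exact max_le (key _ _ (Real.abs_cos_le_one s) (Real.abs_sin_le_one s))
    (key _ _ (by simpa using Real.abs_sin_le_one s) (Real.abs_cos_le_one s))

theorem continuous_rotation {Y : Type*} [TopologicalSpace Y] {s : Y → ℝ} {p : Y → X × X}
    (hs : Continuous s) (hp : Continuous p) :
    Continuous fun y => ContinuousLinearMap.rotation (s y) (p y) := by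
  have hc := Real.continuous_cos.comp hs
  have hs := Real.continuous_sin.comp hs
  exact ((hc.smul hp.fst).add (hs.smul hp.snd)).prodMk ((hs.neg.smul hp.fst).add (hc.smul hp.snd))

end Growth

/-! ### Rotations of a pair of independent Gaussian vectors -/

section Gaussian

variable {X E : Type*} [NormedAddCommGroup X] [NormedSpace ℝ X] [CompleteSpace X]
  [MeasurableSpace X] [BorelSpace X] [SecondCountableTopology X]
  [NormedAddCommGroup E]

theorem integrable_one_add_norm_pow (μ : Measure X) [IsGaussian μ] (N : ℕ) :
    Integrable (fun x => (1 + ‖x‖) ^ N) μ := by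
  have h0 : MemLp (fun x : X => ‖x‖) (N : ENNReal) μ :=
    (IsGaussian.memLp_id μ (N : ENNReal) (ENNReal.natCast_ne_top N)).norm
  have h2 : MemLp (fun _ : X => (1 : ℝ)) (N : ENNReal) μ := memLp_const 1
  have h : MemLp (fun x : X => 1 + ‖x‖) (N : ENNReal) μ := h2.add h0
  have h1 : ∀ x : X, ‖1 + ‖x‖‖ ^ N = (1 + ‖x‖) ^ N := fun x => by
    rw [Real.norm_of_nonneg (add_nonneg zero_le_one (norm_nonneg x))]
  exact h.integrable_norm_pow'.congr (ae_of_all _ h1)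

theorem integrable_of_growth (μ : Measure X) [IsGaussian μ] {g : X → E} (hg : Continuous g)
    {C : ℝ} {N : ℕ} (h : ∀ x, ‖g x‖ ≤ C * (1 + ‖x‖) ^ N) : Integrable g μ :=
  ((integrable_one_add_norm_pow μ N).const_mul C).mono' hg.aestronglyMeasurable (ae_of_all _ h)

theorem integrable_of_temperate [NormedSpace ℝ E] (μ : Measure X) [IsGaussian μ] {g : X → E}
    (hg : g.HasTemperateGrowth) : Integrable g μ := by
  obtain ⟨N, C, -, h, -⟩ := temperate_bounds hg
  exact integrable_of_growth μ hg.1.continuous h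

variable [NormedSpace ℝ E] (μ : Measure X) [IsGaussian μ]

theorem integral_rotation (hμ : ∫ x, x ∂μ = 0) {g : X × X → E} (hg : Continuous g) (s : ℝ) :
    ∫ p, g (ContinuousLinearMap.rotation s p) ∂(μ.prod μ) = ∫ p, g p ∂(μ.prod μ) := by
  conv_rhs => rw [← IsGaussian.map_rotation_eq_self (μ := μ) hμ s]
  rw [integral_map (by fun_prop) hg.aestronglyMeasurable]

/-- Averaging along the arc `s ↦ rotation s p` amounts to averaging over independent pairs, since
the product measure is rotation invariant. -/
theorem integral_intervalIntegral_rotation (hμ : ∫ x, x ∂μ = 0) {g : ℝ → X × X → E}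
    (hg : Continuous (Function.uncurry g)) {C : ℝ} {N : ℕ}
    (h : ∀ s q, ‖g s q‖ ≤ C * (1 + ‖q‖) ^ N) (a b : ℝ) :
    Integrable (fun p => ∫ s in a..b, g s (ContinuousLinearMap.rotation s p)) (μ.prod μ) ∧
    ∫ p, (∫ s in a..b, g s (ContinuousLinearMap.rotation s p)) ∂(μ.prod μ) =
      ∫ s in a..b, ∫ q, g s q ∂(μ.prod μ) := by
  have hC : 0 ≤ C := by simpa using (norm_nonneg _).trans (h 0 0)
  have hcont : Continuous fun q : ℝ × (X × X) => g q.1 (ContinuousLinearMap.rotation q.1 q.2) :=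
    hg.comp (continuous_fst.prodMk (continuous_rotation continuous_fst continuous_snd))
  have : IsFiniteMeasure ((volume : Measure ℝ).restrict (Set.uIoc a b)) :=
    inferInstanceAs (IsFiniteMeasure ((volume : Measure ℝ).restrict (Set.Ioc _ _)))
  have hint : Integrable
      (Function.uncurry fun s p => g s (ContinuousLinearMap.rotation s p))
      ((volume.restrict (Set.uIoc a b)).prod (μ.prod μ)) := by
    have h0 : Integrable (fun p : X × X => C * 2 ^ N * (1 + ‖p‖) ^ N) (μ.prod μ) :=
      (integrable_one_add_norm_pow (μ.prod μ) N).const_mul _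
    refine (h0.comp_snd (volume.restrict (Set.uIoc a b))).mono' hcont.aestronglyMeasurable
      (ae_of_all _ fun q => ?_)
    refine (h _ _).trans ?_
    rw [mul_assoc, ← mul_pow]
    have := norm_rotation_le q.1 q.2
    gcongr
    linarith
  constructor
  · have := hint.integral_prod_right
    rcases le_total a b with hab | hab
    · simpa [intervalIntegral.integral_of_le hab, Set.uIoc_of_le hab] using this
    · simpa [intervalIntegral.integral_of_ge hab, Set.uIoc_of_ge hab] using this.neg
  · rw [← intervalIntegral_integral_swap hint]
    refine intervalIntegral.integral_congr fun s _ => ?_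
    exact integral_rotation μ hμ (hg.comp (continuous_const.prodMk continuous_id)) s

end Gaussian

section Arc

open scoped ContDiff

variable {X E : Type*} [NormedAddCommGroup X] [NormedSpace ℝ X]
  [NormedAddCommGroup E] [NormedSpace ℝ E]

/-- Along the arc from `p.1` to `p.2`, the velocity of the first component of the rotated pair is
its second component. -/
theorem hasDerivAt_comp_rotation {φ : X → E} (hφ : Differentiable ℝ φ) (p : X × X) (s : ℝ) :
    HasDerivAt (fun s => φ (ContinuousLinearMap.rotation s p).1)
      (fderiv ℝ φ (ContinuousLinearMap.rotation s p).1 (ContinuousLinearMap.rotation s p).2) s := by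
  refine (hφ _).hasFDerivAt.comp_hasDerivAt s ?_
  simp only [ContinuousLinearMap.rotation_apply]
  exact ((Real.hasDerivAt_cos s).smul_const p.1).add ((Real.hasDerivAt_sin s).smul_const p.2)

theorem sub_eq_intervalIntegral_rotation [CompleteSpace E] {φ : X → E} (hφ : ContDiff ℝ ∞ φ)
    (p : X × X) :
    φ p.2 - φ p.1 = ∫ s in (0 : ℝ)..(Real.pi / 2), fderiv ℝ φ (ContinuousLinearMap.rotation s p).1
      (ContinuousLinearMap.rotation s p).2 := by
  rw [intervalIntegral.integral_eq_sub_of_hasDerivAt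
    (fun s _ => hasDerivAt_comp_rotation (hφ.differentiable (by simp)) p s)]
  · simp [ContinuousLinearMap.rotation_apply]
  · refine Continuous.intervalIntegrable ?_ _ _
    have h := hφ.continuous_fderiv (by simp)
    have hr : Continuous fun s : ℝ => ContinuousLinearMap.rotation s p :=
      continuous_rotation continuous_id continuous_const
    exact (h.comp hr.fst).clm_apply hr.snd

end Arc

/-! ### The Poincaré inequality and integration by parts -/

section Inequalities

variable {X E : Type*} [NormedAddCommGroup X] [NormedSpace ℝ X] [CompleteSpace X]
  [MeasurableSpace X] [BorelSpace X] [SecondCountableTopology X]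
  [NormedAddCommGroup E] [InnerProductSpace ℝ E]
  (μ : Measure X) [IsGaussian μ]

/-- The derivative of `φ` is a function of polynomial growth of the pair (base point, direction). -/
theorem fderiv_pair_bound {X E : Type*} [NormedAddCommGroup X] [NormedSpace ℝ X]
    [NormedAddCommGroup E] [NormedSpace ℝ E] {φ : X → E} (hφ : φ.HasTemperateGrowth) :
    Continuous (fun q : X × X => fderiv ℝ φ q.1 q.2) ∧
    ∃ (N : ℕ) (C : ℝ), 0 ≤ C ∧ ∀ q : X × X, ‖fderiv ℝ φ q.1 q.2‖ ≤ C * (1 + ‖q‖) ^ N := by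
  refine ⟨((hφ.1.continuous_fderiv (by simp)).comp continuous_fst).clm_apply continuous_snd, ?_⟩
  obtain ⟨N, C, hC, -, h⟩ := temperate_bounds hφ
  refine ⟨N + 1, C, hC, fun q => ?_⟩
  have h1 := norm_fst_le q
  have h2 := norm_snd_le q
  calc ‖fderiv ℝ φ q.1 q.2‖ ≤ ‖fderiv ℝ φ q.1‖ * ‖q.2‖ := ContinuousLinearMap.le_opNorm _ _
    _ ≤ (C * (1 + ‖q.1‖) ^ N) * ‖q.2‖ := by gcongr; exact h _
    _ ≤ (C * (1 + ‖q‖) ^ N) * (1 + ‖q‖) := by gcongr; linarith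
    _ = C * (1 + ‖q‖) ^ (N + 1) := by ring

theorem integrable_fderiv_pair {φ : X → E} (hφ : φ.HasTemperateGrowth) :
    Integrable (fun q : X × X => fderiv ℝ φ q.1 q.2) (μ.prod μ) := by
  obtain ⟨hc, N, C, -, h⟩ := fderiv_pair_bound hφ
  exact integrable_of_growth _ hc h

theorem integrable_inner_fderiv_pair {φ : X → E} (hφ : φ.HasTemperateGrowth) (T : X × X →L[ℝ] E) :
    Integrable (fun q : X × X => inner ℝ (fderiv ℝ φ q.1 q.2) (T q)) (μ.prod μ) := by
  obtain ⟨hc, N, C, hC, h⟩ := fderiv_pair_bound hφ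
  refine integrable_of_growth (N := N + 1) (C := C * ‖T‖) _ (hc.inner T.continuous) fun q => ?_
  calc ‖inner ℝ (fderiv ℝ φ q.1 q.2) (T q)‖ ≤ ‖fderiv ℝ φ q.1 q.2‖ * ‖T q‖ := norm_inner_le_norm _ _
    _ ≤ (C * (1 + ‖q‖) ^ N) * (‖T‖ * (1 + ‖q‖)) := by
      gcongr
      · exact h q
      · exact (T.le_opNorm q).trans (by gcongr; linarith)
    _ = C * ‖T‖ * (1 + ‖q‖) ^ (N + 1) := by ring

/-- The `L¹` Poincaré inequality for a Gaussian measure: the increment of `φ` between independent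
copies is the integral of the derivative along an arc of length `π / 2`. -/
theorem integral_norm_sub_le [CompleteSpace E] (hμ : ∫ x, x ∂μ = 0) {φ : X → E}
    (hφ : φ.HasTemperateGrowth) :
    ∫ p : X × X, ‖φ p.2 - φ p.1‖ ∂(μ.prod μ) ≤
      Real.pi / 2 * ∫ q : X × X, ‖fderiv ℝ φ q.1 q.2‖ ∂(μ.prod μ) := by
  obtain ⟨hc, N, C, -, h⟩ := fderiv_pair_bound hφ
  obtain ⟨hi, he⟩ := integral_intervalIntegral_rotation μ hμ
    (g := fun _ q => ‖fderiv ℝ φ q.1 q.2‖) (hc.norm.comp continuous_snd)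
    (fun _ q => by rw [norm_norm]; exact h q) 0 (Real.pi / 2)
  rw [intervalIntegral.integral_const, sub_zero, smul_eq_mul] at he
  rw [← he]
  refine integral_mono_of_nonneg (ae_of_all _ fun _ => norm_nonneg _) hi (ae_of_all _ fun p => ?_)
  simp only
  rw [sub_eq_intervalIntegral_rotation hφ.1]
  exact intervalIntegral.norm_integral_le_integral_norm (by positivity)

/-- The integrand is linear in the second variable, which is centered and independent of the
first. -/
theorem integral_inner_fderiv_fst (hμ : ∫ x, x ∂μ = 0) {φ : X → E} (hφ : φ.HasTemperateGrowth)
    (T : X →L[ℝ] E) :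
    ∫ q : X × X, inner ℝ (fderiv ℝ φ q.1 q.2) (T q.1) ∂(μ.prod μ) = 0 := by
  have hi : Integrable (fun q : X × X => inner ℝ (fderiv ℝ φ q.1 q.2) (T q.1)) (μ.prod μ) :=
    integrable_inner_fderiv_pair μ hφ (T.comp (.fst ℝ X X))
  rw [integral_prod _ hi]
  refine integral_eq_zero_of_ae (ae_of_all _ fun x => ?_)
  have h := ((innerSL ℝ (T x)).comp (fderiv ℝ φ x)).integral_comp_comm
    (μ := μ) (φ := fun z => z) IsGaussian.integrable_id
  rw [hμ, map_zero] at h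
  simpa [real_inner_comm] using h

/-- Gaussian integration by parts: `𝔼⟪Dφ(X) Z, T Z⟫ = 𝔼⟪φ(X), T X⟫` for independent `X`, `Z`.
Test `φ(Z) - φ(X) = ∫ Dφ(X_s) Z_s ds` against `T Z`, where `(X_s, Z_s)` is the rotated pair and
`Z = sin s X_s + cos s Z_s`; the `cos s` part integrates to one and the `sin s` part vanishes.
No density is used, so `μ` may be degenerate. -/
theorem integral_inner_fderiv [CompleteSpace E] (hμ : ∫ x, x ∂μ = 0) {φ : X → E}
    (hφ : φ.HasTemperateGrowth) (T : X →L[ℝ] E) :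
    ∫ q : X × X, inner ℝ (fderiv ℝ φ q.1 q.2) (T q.2) ∂(μ.prod μ) =
      ∫ x, inner ℝ (φ x) (T x) ∂μ := by
  obtain ⟨hc, N, C, hC, h⟩ := fderiv_pair_bound hφ
  -- The second variable of a pair `p` is recovered from the rotated pair by the inverse rotation.
  let S : ℝ → X × X →L[ℝ] E := fun s =>
    T.comp (Real.sin s • .fst ℝ X X + Real.cos s • .snd ℝ X X)
  have hS : ∀ s q, S s q = Real.sin s • T q.1 + Real.cos s • T q.2 := fun s q => by simp [S]
  have hSrot : ∀ s p, S s (ContinuousLinearMap.rotation s p) = T p.2 := fun s p => by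
    simp only [S, ContinuousLinearMap.rotation_apply, ContinuousLinearMap.comp_apply]
    congr 1
    calc Real.sin s • (Real.cos s • p.1 + Real.sin s • p.2) +
          Real.cos s • (-Real.sin s • p.1 + Real.cos s • p.2)
        = (Real.sin s ^ 2 + Real.cos s ^ 2) • p.2 := by module
      _ = p.2 := by rw [Real.sin_sq_add_cos_sq, one_smul]
  have hScont : Continuous fun q : ℝ × (X × X) => S q.1 q.2 := by
    simp only [hS]
    have hs : Continuous fun q : ℝ × (X × X) => Real.sin q.1 :=
      Real.continuous_sin.comp continuous_fst
    have hco : Continuous fun q : ℝ × (X × X) => Real.cos q.1 :=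
      Real.continuous_cos.comp continuous_fst
    exact (hs.smul (T.continuous.comp continuous_snd.fst)).add
      (hco.smul (T.continuous.comp continuous_snd.snd))
  have hSb : ∀ s q, ‖S s q‖ ≤ 2 * ‖T‖ * (1 + ‖q‖) := fun s q => by
    rw [hS]
    have h1 : ‖T q.1‖ ≤ ‖T‖ * (1 + ‖q‖) :=
      (T.le_opNorm _).trans (by gcongr; linarith [norm_fst_le q])
    have h2 : ‖T q.2‖ ≤ ‖T‖ * (1 + ‖q‖) :=
      (T.le_opNorm _).trans (by gcongr; linarith [norm_snd_le q])
    refine (norm_add_le _ _).trans ?_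
    rw [norm_smul, norm_smul, Real.norm_eq_abs, Real.norm_eq_abs]
    nlinarith [norm_nonneg (T q.1), norm_nonneg (T q.2), Real.abs_sin_le_one s,
      Real.abs_cos_le_one s]
  obtain ⟨-, he⟩ := integral_intervalIntegral_rotation μ hμ
    (g := fun s q => inner ℝ (fderiv ℝ φ q.1 q.2) (S s q))
    (C := C * (2 * ‖T‖)) (N := N + 1)
    ((hc.comp continuous_snd).inner hScont)
    (fun s q => by
      calc ‖inner ℝ (fderiv ℝ φ q.1 q.2) (S s q)‖
          ≤ ‖fderiv ℝ φ q.1 q.2‖ * ‖S s q‖ := norm_inner_le_norm _ _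
        _ ≤ (C * (1 + ‖q‖) ^ N) * (2 * ‖T‖ * (1 + ‖q‖)) := by
          gcongr
          · exact h q
          · exact hSb s q
        _ = C * (2 * ‖T‖) * (1 + ‖q‖) ^ (N + 1) := by ring) 0 (Real.pi / 2)
  have hR : ∀ s, ∫ q : X × X, inner ℝ (fderiv ℝ φ q.1 q.2) (S s q) ∂(μ.prod μ) =
      Real.cos s * ∫ q : X × X, inner ℝ (fderiv ℝ φ q.1 q.2) (T q.2) ∂(μ.prod μ) := fun s => by
    simp only [hS, inner_add_right, inner_smul_right]
    rw [integral_add, integral_const_mul, integral_const_mul, integral_inner_fderiv_fst μ hμ hφ T,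
      mul_zero, zero_add]
    · exact (integrable_inner_fderiv_pair μ hφ (T.comp (.fst ℝ X X))).const_mul _
    · exact (integrable_inner_fderiv_pair μ hφ (T.comp (.snd ℝ X X))).const_mul _
  simp only [hR, hSrot] at he
  rw [intervalIntegral.integral_mul_const, integral_cos, Real.sin_pi_div_two, Real.sin_zero,
    sub_zero, one_mul] at he
  rw [← he]
  obtain ⟨M, D, hD, hφb, -⟩ := temperate_bounds hφ
  have hbound : ∀ q : X × X, ∀ x, ‖x‖ ≤ ‖q‖ →
      ‖inner ℝ (φ x) (T q.2)‖ ≤ D * ‖T‖ * (1 + ‖q‖) ^ (M + 1) := fun q x hx => by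
    calc ‖inner ℝ (φ x) (T q.2)‖ ≤ ‖φ x‖ * ‖T q.2‖ := norm_inner_le_norm _ _
      _ ≤ (D * (1 + ‖q‖) ^ M) * (‖T‖ * (1 + ‖q‖)) := by
        gcongr
        · exact (hφb x).trans (by gcongr)
        · exact (T.le_opNorm _).trans (by gcongr; linarith [norm_snd_le q])
      _ = D * ‖T‖ * (1 + ‖q‖) ^ (M + 1) := by ring
  have hi1 : Integrable (fun q : X × X => inner ℝ (φ q.1) (T q.2)) (μ.prod μ) :=
    integrable_of_growth _ ((hφ.1.continuous.comp continuous_fst).inner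
      (T.continuous.comp continuous_snd)) fun q => hbound q q.1 (norm_fst_le q)
  have hi2 : Integrable (fun q : X × X => inner ℝ (φ q.2) (T q.2)) (μ.prod μ) :=
    integrable_of_growth _ ((hφ.1.continuous.comp continuous_snd).inner
      (T.continuous.comp continuous_snd)) fun q => hbound q q.2 (norm_snd_le q)
  have hz : ∫ q : X × X, inner ℝ (φ q.1) (T q.2) ∂(μ.prod μ) = 0 := by
    rw [integral_prod _ hi1]
    refine integral_eq_zero_of_ae (ae_of_all _ fun x => ?_)
    have h := ((innerSL ℝ (φ x)).comp T).integral_comp_comm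
      (μ := μ) (φ := fun z => z) IsGaussian.integrable_id
    rw [hμ, map_zero] at h
    simpa using h
  have hsub : ∀ p : X × X, ∫ s in (0 : ℝ)..(Real.pi / 2),
      inner ℝ (fderiv ℝ φ (ContinuousLinearMap.rotation s p).1
        (ContinuousLinearMap.rotation s p).2) (T p.2) =
      inner ℝ (φ p.2) (T p.2) - inner ℝ (φ p.1) (T p.2) := fun p => by
    rw [← inner_sub_left, sub_eq_intervalIntegral_rotation hφ.1]
    have hint : IntervalIntegrable (fun s => fderiv ℝ φ (ContinuousLinearMap.rotation s p).1
        (ContinuousLinearMap.rotation s p).2) volume 0 (Real.pi / 2) :=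
      (hc.comp (continuous_rotation continuous_id continuous_const)).intervalIntegrable _ _
    have := (innerSL ℝ (T p.2)).intervalIntegral_comp_comm hint
    simpa [real_inner_comm] using this
  simp only [hsub]
  rw [integral_sub hi2 hi1, hz, sub_zero, integral_prod _ hi2]
  simp

end Inequalities

/-! ### The cutoff -/

section Cutoff

variable {X E : Type*} [NormedAddCommGroup X] [NormedSpace ℝ X]
  [NormedAddCommGroup E] [InnerProductSpace ℝ E]

/-- A smooth cutoff, small where `T x` is large. It makes `cutoff T x • T x` bounded, and
its derivative in the direction `z` is at most `‖T z‖`. -/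
noncomputable def cutoff (T : X →L[ℝ] E) (x : X) : ℝ := (1 + ‖T x‖ ^ 2)⁻¹

theorem cutoff_temperate (T : X →L[ℝ] E) : (cutoff T).HasTemperateGrowth := by
  have h := (Function.hasTemperateGrowth_one_add_norm_sq_rpow (H := E) (-1)).comp
    T.hasTemperateGrowth
  have e : cutoff T = (fun y : E => (1 + ‖y‖ ^ 2) ^ (-1 : ℝ)) ∘ T :=
    funext fun x => (Real.rpow_neg_one _).symm
  rwa [e]

theorem cutoff_nonneg (T : X →L[ℝ] E) (x : X) : 0 ≤ cutoff T x := by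
  unfold cutoff; positivity

theorem cutoff_le_one (T : X →L[ℝ] E) (x : X) : cutoff T x ≤ 1 :=
  inv_le_one_of_one_le₀ (by linarith [sq_nonneg ‖T x‖])

theorem cutoff_mul_norm_le (T : X →L[ℝ] E) (x : X) : cutoff T x * ‖T x‖ ≤ 1 / 2 := by
  unfold cutoff
  rw [inv_mul_eq_div, div_le_iff₀ (by positivity)]
  nlinarith [sq_nonneg (‖T x‖ - 1)]

/-- The tangent to `t ↦ 1 / (1 + t)` at `t = 1` lies below its graph. -/
theorem le_cutoff (T : X →L[ℝ] E) (x : X) : 3 / 4 - ‖T x‖ ^ 2 / 4 ≤ cutoff T x := by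
  unfold cutoff
  rw [inv_eq_one_div, le_div_iff₀ (by positivity)]
  nlinarith [sq_nonneg (‖T x‖ ^ 2 - 1)]

theorem fderiv_cutoff_apply (T : X →L[ℝ] E) (x z : X) :
    fderiv ℝ (cutoff T) x z = -(2 * cutoff T x ^ 2 * inner ℝ (T x) (T z)) := by
  have h1 : HasFDerivAt (fun x => 1 + ‖T x‖ ^ 2)
      (2 • (innerSL ℝ (T x)).comp T) x := (T.hasFDerivAt.norm_sq).const_add 1
  have h2 := (hasDerivAt_inv (x := 1 + ‖T x‖ ^ 2) (by positivity)).comp_hasFDerivAt x h1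
  have h3 : fderiv ℝ (cutoff T) x = _ := h2.fderiv
  rw [h3]
  simp [cutoff]
  ring

theorem abs_fderiv_cutoff_apply_le (T : X →L[ℝ] E) (x z : X) :
    |fderiv ℝ (cutoff T) x z| ≤ ‖T z‖ := by
  rw [fderiv_cutoff_apply, abs_neg, abs_mul, abs_of_nonneg (by positivity)]
  have h0 := cutoff_nonneg T x
  have h1 := cutoff_le_one T x
  have h2 := cutoff_mul_norm_le T x
  calc 2 * cutoff T x ^ 2 * |inner ℝ (T x) (T z)|
      ≤ 2 * cutoff T x ^ 2 * (‖T x‖ * ‖T z‖) := by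
        gcongr; exact abs_real_inner_le_norm _ _
    _ = 2 * (cutoff T x * (cutoff T x * ‖T x‖)) * ‖T z‖ := by ring
    _ ≤ 2 * (1 * (1 / 2)) * ‖T z‖ := by gcongr
    _ = ‖T z‖ := by ring

end Cutoff

/-! ### The interpolation inequality for a Gaussian measure -/

section Interpolation

variable {X E E₁ E₂ : Type*} [NormedAddCommGroup X] [NormedSpace ℝ X] [CompleteSpace X]
  [MeasurableSpace X] [BorelSpace X] [SecondCountableTopology X]
  [NormedAddCommGroup E] [InnerProductSpace ℝ E]
  [NormedAddCommGroup E₁] [InnerProductSpace ℝ E₁]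
  [NormedAddCommGroup E₂]
  (μ : Measure X) [IsGaussian μ]

theorem integrable_norm_sq_clm (T : X →L[ℝ] E) : Integrable (fun z => ‖T z‖ ^ 2) μ :=
  (T.comp_memLp' IsGaussian.memLp_two_id).integrable_norm_pow (by simp)

/-- The contribution of the region where `T` is not too large: integration by parts turns a
derivative of `G`, tested against `T` and cut off, into an average of `G`. -/
theorem integral_cutoff_mul_le [CompleteSpace E] (hμ : ∫ x, x ∂μ = 0) {G : X → E}
    (hG : G.HasTemperateGrowth) (T : X →L[ℝ] E) (hT : ∫ z, ‖T z‖ ^ 2 ∂μ = 1) :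
    ∫ x, cutoff T x * ∫ z, inner ℝ (fderiv ℝ G x z) (T z) ∂μ ∂μ ≤ 3 / 2 * ∫ x, ‖G x‖ ∂μ := by
  have hχ := cutoff_temperate T
  have hφ : (fun x => cutoff T x • G x).HasTemperateGrowth := by fun_prop
  have hGi : Integrable (fun x => ‖G x‖) μ := (integrable_of_temperate μ hG).norm
  have hfd : ∀ q : X × X, inner ℝ (fderiv ℝ (fun x => cutoff T x • G x) q.1 q.2) (T q.2) =
      cutoff T q.1 * inner ℝ (fderiv ℝ G q.1 q.2) (T q.2) +
        fderiv ℝ (cutoff T) q.1 q.2 * inner ℝ (G q.1) (T q.2) := fun q => by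
    rw [fderiv_fun_smul (hχ.1.differentiable (by simp) _) (hG.1.differentiable (by simp) _)]
    simp [inner_add_left, inner_smul_left]
  have hi0 : Integrable (fun q : X × X => inner ℝ (fderiv ℝ G q.1 q.2) (T q.2)) (μ.prod μ) :=
    integrable_inner_fderiv_pair μ hG (T.comp (.snd ℝ X X))
  have hi1 : Integrable (fun q : X × X =>
      cutoff T q.1 * inner ℝ (fderiv ℝ G q.1 q.2) (T q.2)) (μ.prod μ) := by
    refine hi0.bdd_mul (c := 1) (hχ.1.continuous.comp continuous_fst).aestronglyMeasurable
      (ae_of_all _ fun q => ?_)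
    rw [Real.norm_of_nonneg (cutoff_nonneg _ _)]
    exact cutoff_le_one _ _
  have hi2 : Integrable (fun q : X × X => ‖G q.1‖ * ‖T q.2‖ ^ 2) (μ.prod μ) :=
    hGi.mul_prod (integrable_norm_sq_clm μ T)
  have hb : ∀ q : X × X, ‖fderiv ℝ (cutoff T) q.1 q.2 * inner ℝ (G q.1) (T q.2)‖ ≤
      ‖G q.1‖ * ‖T q.2‖ ^ 2 := fun q => by
    rw [norm_mul, Real.norm_eq_abs]
    calc _ ≤ ‖T q.2‖ * (‖G q.1‖ * ‖T q.2‖) := by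
          gcongr
          · exact abs_fderiv_cutoff_apply_le _ _ _
          · exact norm_inner_le_norm _ _
      _ = _ := by ring
  have hi3 : Integrable (fun q : X × X =>
      fderiv ℝ (cutoff T) q.1 q.2 * inner ℝ (G q.1) (T q.2)) (μ.prod μ) :=
    hi2.mono' (((fderiv_pair_bound hχ).1).mul ((hG.1.continuous.comp continuous_fst).inner
      (T.continuous.comp continuous_snd))).aestronglyMeasurable (ae_of_all _ hb)
  have hibp := integral_inner_fderiv μ hμ hφ T
  simp only [hfd] at hibp
  rw [integral_add hi1 hi3, integral_prod _ hi1] at hibp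
  simp only [integral_const_mul] at hibp
  have h3 : |∫ q : X × X, fderiv ℝ (cutoff T) q.1 q.2 * inner ℝ (G q.1) (T q.2) ∂(μ.prod μ)| ≤
      ∫ x, ‖G x‖ ∂μ := by
    refine (norm_integral_le_of_norm_le hi2 (ae_of_all _ hb)).trans_eq ?_
    rw [integral_prod_mul (fun x => ‖G x‖) (fun z => ‖T z‖ ^ 2), hT, mul_one]
  have h4 : ∫ x, inner ℝ (cutoff T x • G x) (T x) ∂μ ≤ 1 / 2 * ∫ x, ‖G x‖ ∂μ := by
    rw [← integral_const_mul]
    refine (Real.le_norm_self _).trans (norm_integral_le_of_norm_le (hGi.const_mul _)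
      (ae_of_all _ fun x => ?_))
    refine (norm_inner_le_norm _ _).trans ?_
    rw [norm_smul, Real.norm_of_nonneg (cutoff_nonneg _ _)]
    nlinarith [cutoff_mul_norm_le T x, norm_nonneg (G x)]
  linarith [neg_le_of_abs_le h3]

/-- A pointwise bound for the gradient `G₁` of `G` by its mean oscillation around that point and the
mean of `G`. The hypothesis `h₁` says that `G₁ x` represents the operator `fderiv ℝ G x` with the
Hilbert-Schmidt inner product of the Cameron-Martin space of `μ`. -/
theorem norm_gradient_le [CompleteSpace E] (hμ : ∫ x, x ∂μ = 0) {G : X → E} {G₁ : X → E₁}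
    (hG : G.HasTemperateGrowth) (hG₁ : G₁.HasTemperateGrowth)
    (h₁ : ∀ x y, ∫ z, inner ℝ (fderiv ℝ G x z) (fderiv ℝ G y z) ∂μ = inner ℝ (G₁ x) (G₁ y))
    (y : X) :
    ‖G₁ y‖ ≤ 2 * ∫ x, ‖G₁ y - G₁ x‖ ∂μ + 3 * ∫ x, ‖G x‖ ∂μ := by
  rcases (norm_nonneg (G₁ y)).eq_or_lt with h0 | hN
  · rw [← h0]; positivity
  set N := ‖G₁ y‖ with hNdef
  -- The direction of the gradient at `y`, as an operator of Hilbert-Schmidt norm one.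
  let T : X →L[ℝ] E := N⁻¹ • fderiv ℝ G y
  have hTz : ∀ z, T z = N⁻¹ • fderiv ℝ G y z := fun z => rfl
  have hTi := integrable_norm_sq_clm μ T
  have hT : ∫ z, ‖T z‖ ^ 2 ∂μ = 1 := by
    simp only [hTz, ← real_inner_self_eq_norm_sq, real_inner_smul_left, real_inner_smul_right,
      integral_const_mul, h₁]
    rw [real_inner_self_eq_norm_sq (G₁ y), ← hNdef]
    field_simp
  -- After the cutoff, the component of the gradient along its value at `y` is controlled by `G`.
  have hmain := integral_cutoff_mul_le μ hμ hG T hT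
  simp only [hTz, inner_smul_right, integral_const_mul, h₁] at hmain
  have hG₁i := integrable_of_temperate μ hG₁
  have hdi : Integrable (fun x => ‖G₁ y - G₁ x‖) μ := ((integrable_const _).sub hG₁i).norm
  have hχi : Integrable (fun x => cutoff T x * (N⁻¹ * inner ℝ (G₁ x) (G₁ y))) μ := by
    have hχ := cutoff_temperate T
    refine ((hG₁i.inner_const (G₁ y)).const_mul N⁻¹).bdd_mul (c := 1)
      hχ.1.continuous.aestronglyMeasurable (ae_of_all _ fun x => ?_)
    rw [Real.norm_of_nonneg (cutoff_nonneg _ _)]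
    exact cutoff_le_one _ _
  have hlow : ∀ x, N * (3 / 4 - ‖T x‖ ^ 2 / 4) - ‖G₁ y - G₁ x‖ ≤
      cutoff T x * (N⁻¹ * inner ℝ (G₁ x) (G₁ y)) := fun x => by
    have e : N⁻¹ * inner ℝ (G₁ x) (G₁ y) = N - N⁻¹ * inner ℝ (G₁ y - G₁ x) (G₁ y) := by
      rw [inner_sub_left, real_inner_self_eq_norm_sq, ← hNdef]
      field_simp
      ring
    have b : N⁻¹ * inner ℝ (G₁ y - G₁ x) (G₁ y) ≤ ‖G₁ y - G₁ x‖ := by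
      rw [inv_mul_le_iff₀ hN, mul_comm]
      exact real_inner_le_norm _ _
    rw [e]
    nlinarith [le_cutoff T x, cutoff_nonneg T x, cutoff_le_one T x, norm_nonneg (G₁ y - G₁ x)]
  have hq : Integrable (fun x => N * (3 / 4 - ‖T x‖ ^ 2 / 4)) μ :=
    ((integrable_const _).sub (hTi.div_const 4)).const_mul N
  have hsub : Integrable (fun x => N * (3 / 4 - ‖T x‖ ^ 2 / 4) - ‖G₁ y - G₁ x‖) μ := hq.sub hdi
  have hint := integral_mono hsub hχi hlow
  have he : ∫ x, N * (3 / 4 - ‖T x‖ ^ 2 / 4) ∂μ = N / 2 := by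
    rw [integral_const_mul, integral_sub (integrable_const _) (hTi.div_const 4),
      integral_div (4 : ℝ) (fun x => ‖T x‖ ^ 2), hT, integral_const, probReal_univ]
    ring
  rw [integral_sub hq hdi, he] at hint
  linarith

theorem integral_norm_clm_le (T : X →L[ℝ] E) {c : ℝ} (hc : 0 ≤ c)
    (h : ∫ z, ‖T z‖ ^ 2 ∂μ = c ^ 2) : ∫ z, ‖T z‖ ∂μ ≤ c := by
  refine abs_le_of_sq_le_sq' ?_ hc |>.2
  have hi : MemLp (fun z => ‖T z‖) 2 μ := (T.comp_memLp' IsGaussian.memLp_two_id).norm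
  have := variance_nonneg (fun z => ‖T z‖) μ
  rw [variance_eq_sub hi] at this
  simp only [Pi.pow_apply] at this
  linarith

/-- The interpolation inequality: average the pointwise bound over the base point, and control the
mean oscillation of `G₁` by the Poincaré inequality. As in `norm_gradient_le`, `G₁` represents the
derivative of `G`; likewise `‖G₂ x‖` is the Hilbert-Schmidt norm of the derivative of `G₁`. -/
theorem integral_norm_gradient_le [CompleteSpace E] [CompleteSpace E₁] (hμ : ∫ x, x ∂μ = 0)
    {G : X → E} {G₁ : X → E₁} {G₂ : X → E₂}
    (hG : G.HasTemperateGrowth) (hG₁ : G₁.HasTemperateGrowth) (hG₂ : Integrable G₂ μ)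
    (h₁ : ∀ x y, ∫ z, inner ℝ (fderiv ℝ G x z) (fderiv ℝ G y z) ∂μ = inner ℝ (G₁ x) (G₁ y))
    (h₂ : ∀ x, ∫ z, ‖fderiv ℝ G₁ x z‖ ^ 2 ∂μ = ‖G₂ x‖ ^ 2) :
    ∫ x, ‖G₁ x‖ ∂μ ≤ 3 * ∫ x, ‖G x‖ ∂μ + Real.pi * ∫ x, ‖G₂ x‖ ∂μ := by
  have hG₁i := integrable_of_temperate μ hG₁
  have hd : Integrable (fun p : X × X => ‖G₁ p.2 - G₁ p.1‖) (μ.prod μ) :=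
    ((hG₁i.comp_snd μ).sub (hG₁i.comp_fst μ)).norm
  have hdir := integrable_fderiv_pair μ hG₁
  have hpoinc := integral_norm_sub_le μ hμ hG₁
  have hsec : ∫ q : X × X, ‖fderiv ℝ G₁ q.1 q.2‖ ∂(μ.prod μ) ≤ ∫ x, ‖G₂ x‖ ∂μ := by
    rw [integral_prod _ hdir.norm]
    refine integral_mono hdir.norm.integral_prod_left hG₂.norm fun x => ?_
    exact integral_norm_clm_le μ _ (norm_nonneg _) (h₂ x)
  rw [integral_prod_symm _ hd] at hpoinc
  have hr : Integrable (fun y => 2 * ∫ x, ‖G₁ y - G₁ x‖ ∂μ) μ := hd.integral_prod_right.const_mul 2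
  have hmono := integral_mono hG₁i.norm
    (hr.add (integrable_const (3 * ∫ x, ‖G x‖ ∂μ)))
    (fun y => norm_gradient_le μ hμ hG hG₁ h₁ y)
  rw [integral_add' hr (integrable_const _), integral_const_mul, integral_const, probReal_univ,
    one_smul] at hmono
  have := mul_le_mul_of_nonneg_left hsec Real.pi_pos.le
  linarith

end Interpolation

/-! ### Tensoring from the left -/

section Tensor

variable {H : Type u} [NormedAddCommGroup H] [InnerProductSpace ℝ H]
  {V : Type v} [NormedAddCommGroup V] [InnerProductSpace ℝ V] [CompleteSpace V]

/-- The map `t ↦ h ⊗ t` from `H^{⊗ k} ⊗ V` to `H^{⊗ (k + 1)} ⊗ V`. -/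
noncomputable def tensorLeft (k : ℕ) (h : H) : HTensor H V k →ₗ[ℝ] HTensor H V (k + 1) :=
  (UniformSpace.Completion.toComplL (𝕜 := ℝ)
    (E := H ⊗[ℝ] (tensorHilbert H V k).carrier)).toLinearMap.comp
      (TensorProduct.mk ℝ H (tensorHilbert H V k).carrier h)

theorem inner_tensorLeft (k : ℕ) (h g : H) (s t : HTensor H V k) :
    inner ℝ (tensorLeft k h s) (tensorLeft k g t) = inner ℝ h g * inner ℝ s t :=
  (UniformSpace.Completion.inner_coe (𝕜 := ℝ) (h ⊗ₜ[ℝ] s) (g ⊗ₜ[ℝ] t)).trans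
    (TensorProduct.inner_tmul ..)

end Tensor

/-! ### The law of finitely many variables of an isonormal process -/

section Law

variable {H : Type u} [NormedAddCommGroup H] [InnerProductSpace ℝ H]
  {Ω : Type w} [MeasurableSpace Ω] {P : Measure Ω} {W : H → Ω → ℝ}
  {ι : Type*} [Fintype ι]

theorem IsIsonormal.isGaussian_map (hW : IsIsonormal W P) (h : ι → H) :
    IsGaussian (P.map fun ω p => W (h p) ω) := by
  have hg := (hW.gaussian.comp_right h).hasGaussianLaw Finset.univ
  have hg' := hg.map (ContinuousLinearMap.pi fun p : ι =>
    ContinuousLinearMap.proj (R := ℝ) (φ := fun _ : (Finset.univ : Finset ι) => ℝ)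
      ⟨p, Finset.mem_univ p⟩)
  exact hg'.isGaussian_map

theorem IsIsonormal.aemeasurable_pi (hW : IsIsonormal W P) (h : ι → H) :
    AEMeasurable (fun ω p => W (h p) ω) P :=
  aemeasurable_pi_lambda _ fun p => hW.gaussian.aemeasurable (h p)

theorem IsIsonormal.integral_id_map (hW : IsIsonormal W P) (h : ι → H) :
    ∫ x, x ∂(P.map fun ω p => W (h p) ω) = 0 := by
  have := hW.isGaussian_map h
  ext p
  have hc := (ContinuousLinearMap.proj (R := ℝ) (φ := fun _ : ι => ℝ) p).integral_comp_comm
    (IsGaussian.integrable_id (μ := P.map fun ω p => W (h p) ω))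
  have hm : ∫ x, x p ∂(P.map fun ω p => W (h p) ω) = 0 := by
    rw [integral_map (hW.aemeasurable_pi h) (measurable_pi_apply p).aestronglyMeasurable]
    exact hW.centered (h p)
  simpa [hm] using hc.symm

theorem IsIsonormal.integral_mul_map (hW : IsIsonormal W P) (h : ι → H) (p q : ι) :
    ∫ x, x p * x q ∂(P.map fun ω p => W (h p) ω) = inner ℝ (h p) (h q) := by
  have hm : Measurable fun x : ι → ℝ => x p * x q :=
    (measurable_pi_apply p).mul (measurable_pi_apply q)
  rw [integral_map (hW.aemeasurable_pi h) hm.aestronglyMeasurable]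
  exact hW.covariance (h p) (h q)

/-- If `μ` is the law of `(W (h p))_p` and `Z p` are the coordinates, then the map
`∑ h p ⊗ u p ↦ ∑ Z p • u p` into `L²(μ; H^{⊗ k} ⊗ V)` preserves inner products. -/
theorem IsIsonormal.integral_inner_sum {V : Type v} [NormedAddCommGroup V] [InnerProductSpace ℝ V]
    [CompleteSpace V] (hW : IsIsonormal W P) (h : ι → H) (k : ℕ) (s t : ι → HTensor H V k) :
    ∫ z, inner ℝ (∑ p, z p • s p) (∑ p, z p • t p) ∂(P.map fun ω p => W (h p) ω) =
      inner ℝ (∑ p, tensorLeft k (h p) (s p)) (∑ p, tensorLeft k (h p) (t p)) := by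
  have := hW.isGaussian_map h
  have hL : ∀ p, MemLp (fun z : ι → ℝ => z p) 2 (P.map fun ω p => W (h p) ω) := fun p =>
    (ContinuousLinearMap.proj (R := ℝ) (φ := fun _ : ι => ℝ) p).comp_memLp'
      IsGaussian.memLp_two_id
  simp only [sum_inner, inner_sum, real_inner_smul_left, real_inner_smul_right, inner_tensorLeft,
    ← mul_assoc]
  have hi : ∀ p q (c : ℝ), Integrable (fun z : ι → ℝ => z p * z q * c)
      (P.map fun ω p => W (h p) ω) := fun p q c => ((hL p).integrable_mul (hL q)).mul_const c
  rw [integral_finsetSum _ fun p _ => integrable_finsetSum _ fun q _ => hi _ _ _]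
  refine Finset.sum_congr rfl fun p _ => ?_
  rw [integral_finsetSum _ fun q _ => hi _ _ _]
  refine Finset.sum_congr rfl fun q _ => ?_
  rw [integral_mul_const, hW.integral_mul_map h, real_inner_comm]

end Law

/-! ### Malliavin derivatives as functions of a Gaussian vector -/

section Profile

variable {H : Type u} {V : Type v}

theorem SmoothScalar.partialDeriv_cons (F : SmoothScalar H) {k : ℕ} (a : Fin F.m)
    (i : Fin k → Fin F.m) (x : EuclideanSpace ℝ (Fin F.m)) :
    F.partialDeriv (Fin.cons a i : Fin (k + 1) → Fin F.m) x =
      fderiv ℝ (F.partialDeriv i) x (EuclideanSpace.single a 1) := by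
  have hd : DifferentiableAt ℝ (iteratedFDeriv ℝ k F.f) x :=
    (F.smooth.1.differentiable_iteratedFDeriv (by exact_mod_cast WithTop.coe_lt_top _)) x
  exact hd.iteratedFDeriv_succ_apply_left'

theorem SmoothScalar.temperate_partialDeriv (F : SmoothScalar H) {k : ℕ} (i : Fin k → Fin F.m) :
    (F.partialDeriv i).HasTemperateGrowth := by
  induction k with
  | zero =>
    have e : F.partialDeriv i = F.f := funext fun x => by simp [SmoothScalar.partialDeriv]
    rw [e]
    exact F.smooth
  | succ k ih =>
    have e : F.partialDeriv i =
        fun x => fderiv ℝ (F.partialDeriv (Fin.tail i)) x (EuclideanSpace.single (i 0) 1) :=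
      funext fun x => by rw [← F.partialDeriv_cons, Fin.cons_self_tail]
    rw [e]
    exact temperate_fderiv_apply (ih _) _

theorem SmoothScalar.fderiv_partialDeriv (F : SmoothScalar H) {k : ℕ} (i : Fin k → Fin F.m)
    (x z : EuclideanSpace ℝ (Fin F.m)) :
    fderiv ℝ (F.partialDeriv i) x z =
      ∑ a, z a * F.partialDeriv (Fin.cons a i : Fin (k + 1) → Fin F.m) x := by
  simp only [SmoothScalar.partialDeriv_cons]
  conv_lhs => rw [← (EuclideanSpace.basisFun (Fin F.m) ℝ).sum_repr z]
  simp [map_sum]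

/-- The index set of all the Gaussian variables `W (h_{j, i})` used by `F`. Repeated or linearly
dependent vectors are kept apart, so that the law of these variables may be degenerate. -/
abbrev SmoothVector.Index (F : SmoothVector H V) : Type := (j : Fin F.J) × Fin (F.F j).m

/-- The family of all the vectors `h_{j, i}` used by `F`. -/
def SmoothVector.vec (F : SmoothVector H V) (p : F.Index) : H := (F.F p.1).h p.2

/-- The projection to the variables of the `j`-th summand of `F`. -/
noncomputable def SmoothVector.slot (F : SmoothVector H V) (j : Fin F.J) :
    (F.Index → ℝ) →L[ℝ] EuclideanSpace ℝ (Fin (F.F j).m) :=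
  (EuclideanSpace.equiv (Fin (F.F j).m) ℝ).symm.toContinuousLinearMap.comp
    (ContinuousLinearMap.pi fun i => ContinuousLinearMap.proj ⟨j, i⟩)

theorem SmoothVector.slot_apply (F : SmoothVector H V) (j : Fin F.J) (x : F.Index → ℝ)
    (i : Fin (F.F j).m) : F.slot j x i = x ⟨j, i⟩ := rfl

variable [NormedAddCommGroup H] [InnerProductSpace ℝ H]
  [NormedAddCommGroup V] [InnerProductSpace ℝ V] [CompleteSpace V]

/-- The `k`-th Malliavin derivative of `F`, as a function of the Gaussian vector
`(W (h_{j, i}))`. -/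
noncomputable def SmoothVector.profile (F : SmoothVector H V) (k : ℕ) (x : F.Index → ℝ) :
    HTensor H V k :=
  ∑ j, ∑ i : Fin k → Fin (F.F j).m,
    (F.F j).partialDeriv i (F.slot j x) • pureTensor k (fun r => (F.F j).h (i r)) (F.v j)

/-- The partial derivative of `F.profile k` with respect to the variable `p`, see
`SmoothVector.fderiv_profile`. -/
noncomputable def SmoothVector.partialProfile (F : SmoothVector H V) (k : ℕ) (p : F.Index)
    (x : F.Index → ℝ) : HTensor H V k :=
  ∑ i : Fin k → Fin (F.F p.1).m,
    (F.F p.1).partialDeriv (Fin.cons p.2 i : Fin (k + 1) → Fin (F.F p.1).m) (F.slot p.1 x) •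
      pureTensor k (fun r => (F.F p.1).h (i r)) (F.v p.1)

theorem SmoothVector.temperate_profile (F : SmoothVector H V) (k : ℕ) :
    (F.profile k).HasTemperateGrowth := by
  refine Function.HasTemperateGrowth.sum fun j _ => Function.HasTemperateGrowth.sum fun i _ => ?_
  exact (((F.F j).temperate_partialDeriv i).comp (F.slot j).hasTemperateGrowth).smul
    (Function.HasTemperateGrowth.const _)

theorem SmoothVector.fderiv_profile (F : SmoothVector H V) (k : ℕ) (x z : F.Index → ℝ) :
    fderiv ℝ (F.profile k) x z = ∑ p, z p • F.partialProfile k p x := by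
  have hd : HasFDerivAt (F.profile k)
      (∑ j, ∑ i : Fin k → Fin (F.F j).m,
        ((fderiv ℝ ((F.F j).partialDeriv i) (F.slot j x)).comp (F.slot j)).smulRight
          (pureTensor k (fun r => (F.F j).h (i r)) (F.v j))) x := by
    refine HasFDerivAt.fun_sum fun j _ => HasFDerivAt.fun_sum fun i _ => ?_
    refine HasFDerivAt.smul_const ?_ _
    exact (((F.F j).temperate_partialDeriv i).1.differentiable (by simp) _).hasFDerivAt.comp x
      (F.slot j).hasFDerivAt
  rw [hd.fderiv, Fintype.sum_sigma]
  simp only [sum_apply, ContinuousLinearMap.smulRight_apply,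
    ContinuousLinearMap.comp_apply, SmoothScalar.fderiv_partialDeriv, SmoothVector.partialProfile,
    SmoothVector.slot_apply, Finset.smul_sum, Finset.sum_smul, mul_smul]
  exact Finset.sum_congr rfl fun j _ => Finset.sum_comm

/-- The derivative of order `k + 1` is the gradient of the derivative of order `k`. -/
theorem SmoothVector.profile_succ (F : SmoothVector H V) (k : ℕ) (x : F.Index → ℝ) :
    F.profile (k + 1) x = ∑ p, tensorLeft k (F.vec p) (F.partialProfile k p x) := by
  rw [Fintype.sum_sigma]
  refine Finset.sum_congr rfl fun j _ => ?_
  rw [← (Fin.consEquiv fun _ => Fin (F.F j).m).sum_comp, Fintype.sum_prod_type]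
  refine Finset.sum_congr rfl fun a _ => ?_
  simp only [SmoothVector.partialProfile, map_sum, map_smul]
  rfl

end Profile

end Malliavin

theorem theorem2p2
    {H : Type u} [NormedAddCommGroup H] [InnerProductSpace ℝ H] [CompleteSpace H]
    [TopologicalSpace.SeparableSpace H]
    {V : Type v} [NormedAddCommGroup V] [InnerProductSpace ℝ V] [CompleteSpace V]
    [TopologicalSpace.SeparableSpace V]
    {Ω : Type w} [MeasurableSpace Ω] (P : Measure Ω) [IsProbabilityMeasure P]
    (W : H → Ω → ℝ) (hW : Malliavin.IsIsonormal W P)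
    (l : ℕ) (hl : 1 ≤ l) (F : Malliavin.SmoothVector H V) :
    (∀ k : ℕ, MemLp (F.malliavinD W k) 1 P) ∧
      Malliavin.L1norm P (F.malliavinD W l) ≤
        ENNReal.ofReal Malliavin.eta *
          (Malliavin.L1norm P (F.malliavinD W (l - 1)) +
            Malliavin.L1norm P (F.malliavinD W (l + 1))) := by
  have hY := hW.aemeasurable_pi F.vec
  set Y : Ω → F.Index → ℝ := fun ω p => W (F.vec p) ω
  have hgauss : IsGaussian (P.map Y) := hW.isGaussian_map F.vec
  have hint : ∀ k, Integrable (F.profile k) (P.map Y) := fun k =>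
    Malliavin.integrable_of_temperate _ (F.temperate_profile k)
  have hcomp : ∀ k, F.malliavinD W k = F.profile k ∘ Y := fun k => rfl
  have hmem : ∀ k, MemLp (F.malliavinD W k) 1 P := fun k => by
    rw [hcomp, memLp_one_iff_integrable]
    exact (hint k).comp_aemeasurable hY
  refine ⟨hmem, ?_⟩
  obtain ⟨k, rfl⟩ : ∃ k, l = k + 1 := ⟨l - 1, by omega⟩
  have hnorm : ∀ k, Malliavin.L1norm P (F.malliavinD W k) =
      ENNReal.ofReal (∫ x, ‖F.profile k x‖ ∂(P.map Y)) := fun k => by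
    rw [Malliavin.L1norm, hcomp, ← eLpNorm_map_measure (hint k).aestronglyMeasurable hY,
      eLpNorm_one_eq_lintegral_enorm, ofReal_integral_norm_eq_lintegral_enorm (hint k)]
  have hmain := Malliavin.integral_norm_gradient_le (P.map Y) (hW.integral_id_map F.vec)
    (F.temperate_profile k) (F.temperate_profile (k + 1)) (hint (k + 2))
    (fun x y => by
      simp only [F.fderiv_profile, F.profile_succ]
      exact hW.integral_inner_sum F.vec k _ _)
    (fun x => by
      simp only [← real_inner_self_eq_norm_sq, F.fderiv_profile, F.profile_succ (k + 1)]
      exact hW.integral_inner_sum F.vec (k + 1) _ _)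
  have h0 : ∀ k, 0 ≤ ∫ x, ‖F.profile k x‖ ∂(P.map Y) := fun k =>
    integral_nonneg fun _ => norm_nonneg _
  have heta : 4 ≤ Malliavin.eta := by
    have h2 : 1 ≤ Real.sqrt (2 * Real.exp 1) := by
      rw [Real.one_le_sqrt]
      linarith [Real.add_one_le_exp 1]
    unfold Malliavin.eta
    linarith [Real.pi_pos]
  rw [Nat.add_sub_cancel, hnorm, hnorm, hnorm, ← ENNReal.ofReal_add (h0 _) (h0 _),
    ← ENNReal.ofReal_mul (by linarith)]
  refine ENNReal.ofReal_le_ofReal (hmain.trans ?_)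
  have ha : 3 * ∫ x, ‖F.profile k x‖ ∂(P.map Y) ≤
      Malliavin.eta * ∫ x, ‖F.profile k x‖ ∂(P.map Y) :=
    mul_le_mul_of_nonneg_right (by linarith) (h0 _)
  have hb : Real.pi * ∫ x, ‖F.profile (k + 2) x‖ ∂(P.map Y) ≤
      Malliavin.eta * ∫ x, ‖F.profile (k + 2) x‖ ∂(P.map Y) :=
    mul_le_mul_of_nonneg_right (by linarith [Real.pi_le_four]) (h0 _)
  rw [mul_add]
  exact add_le_add ha hb
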